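/- Let $m\ge 1$ and $n\ge 0$ be integers and let $\Omega=\{1,\dots,m\}^{\mathbb N}$ with the distance $d(x,y)=2^{-k}$, where $k$ is the first index with $x_k\ne y_k$ (and $d(x,x)=0$). Let $\mathcal M$ be the set of Borel probabilities on $\Omega$ with the Monge–Kantorovich metric $d_{MK}(\mu,\nu)=\sup\{\int f\,d\mu-\int f\,d\nu : f:\Omega\to\mathbb R \text{ is } 1\text{-Lipschitz}\}$ (a compact metric space), and let $\mathfrak M$ be the set of Borel probabilities on $\mathcal M$. Let $\mathfrak T:\mathcal M\to\mathcal M$ be the push-forward by the shift $\sigma(x_1,x_2,\dots)=(x_2,x_3,\dots)$, and for $\eta,\mu\in\mathcal M$ let $\eta *_n\mu\in\mathcal M$ be the image of $\eta\times\mu$ under $R_n(x,y)=(x_1,\dots,x_n,y_1,y_2,\dots)$. Put $\phi_\nu(\mu)=\mathfrak T(\nu)*_n\mu$ for $\nu,\mu\in\mathcal M$. Fix a continuous function $A:\mathcal M\to\mathbb R$ and $\Pi_0\in\mathfrak M$, and let $B_{\Pi_0}$ be the bounded operator on the Banach space $C(\mathcal M,\mathbb R)$ given by $$B_{\Pi_0}(F)(\mu)=\int_{\mathcal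 M} e^{A(\phi_\nu(\mu))}\,F(\phi_\nu(\mu))\,d\Pi_0(\nu).$$ Let $\rho(B_{\Pi_0})=\sup\{|k| : k\in\mathbb R,\ k\,\mathrm{Id}-B_{\Pi_0}\text{ is not invertible}\}$ be its spectral radius on $C(\mathcal M,\mathbb R)$, and let the dual operator be given by $\int F\,d(B_{\Pi_0}^*\Pi)=\int B_{\Pi_0}(F)\,d\Pi$ for all $F\in C(\mathcal M,\mathbb R)$. Then there exists a real number $\rho$ with $0<\rho\le\rho(B_{\Pi_0})$ such that the set $$\mathcal G^*(\Pi_0)=\{\Pi\in\mathfrak M : B_{\Pi_0}^*\Pi=\rho\,\Pi\}$$ is not empty; that is, there is $\Pi\in\mathfrak M$ with $\int B_{\Pi_0}(F)\,d\Pi=\rho\int F\,d\Pi$ for every continuous $F:\mathcal M\to\mathbb R$. -/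

import Mathlib

open MeasureTheory Filter Topology

noncomputable section

namespace LevelTwo

/-! ### The symbolic space -/

/-- The symbolic space `{1, …, m}^ℕ`, with its product topology and Borel σ-algebra. -/
abbrev Omega (m : ℕ) : Type := ℕ → Fin m

open Classical in
/-- The distance `2^{-k}`, where `k` is the first place (counted from `1`) at which the two sequences
differ. As `PiNat.firstDiff` counts places from `0`, the exponent is `firstDiff x y + 1`. -/
def dOmega {m : ℕ} (x y : Omega m) : ℝ :=
  if x = y then 0 else (1 / 2 : ℝ) ^ (PiNat.firstDiff x y + 1)

/-- The shift `(x₁, x₂, x₃, …) ↦ (x₂, x₃, …)`. -/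
def shift {m : ℕ} (x : Omega m) : Omega m := fun i => x (i + 1)

/-- The kernel `R_n(x, y) = (x₁, …, x_n, y₁, y₂, …)`. -/
def concat {m : ℕ} (n : ℕ) (x y : Omega m) : Omega m :=
  fun i => if i < n then x i else y (i - n)

/-- Lipschitz functions with constant at most `1`. -/
def IsLip1 {m : ℕ} (f : Omega m → ℝ) : Prop := ∀ x y, |f x - f y| ≤ dOmega x y

theorem dOmega_nonneg {m : ℕ} (x y : Omega m) : 0 ≤ dOmega x y := by
  unfold dOmega; split_ifs <;> positivity

theorem dOmega_le {m : ℕ} {x y : Omega m} {k : ℕ} (h : ∀ i < k, x i = y i) :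
    dOmega x y ≤ (1 / 2 : ℝ) ^ k := by
  unfold dOmega
  split_ifs with hxy
  · positivity
  · have hk : k ≤ PiNat.firstDiff x y := by
      by_contra hlt
      exact PiNat.apply_firstDiff_ne hxy (h _ (by omega))
    exact pow_le_pow_of_le_one (by norm_num) (by norm_num) (by omega)

theorem dOmega_le_one {m : ℕ} (x y : Omega m) : dOmega x y ≤ 1 := by
  simpa using dOmega_le (x := x) (y := y) (k := 0) (by simp)

theorem IsLip1.continuous {m : ℕ} {f : Omega m → ℝ} (hf : IsLip1 f) : Continuous f := by
  rw [continuous_iff_continuousAt]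
  intro x
  rw [ContinuousAt, Metric.tendsto_nhds]
  intro ε hε
  obtain ⟨k, hk⟩ := exists_pow_lt_of_lt_one hε (show (1 / 2 : ℝ) < 1 by norm_num)
  filter_upwards [(PiNat.isOpen_cylinder _ x k).mem_nhds (PiNat.self_mem_cylinder x k)] with y hy
  rw [Real.dist_eq]
  exact (hf y x).trans_lt ((dOmega_le hy).trans_lt hk)

theorem IsLip1.integrable {m : ℕ} {f : Omega m → ℝ} (hf : IsLip1 f) (μ : Measure (Omega m))
    [IsFiniteMeasure μ] : Integrable f μ :=
  (BoundedContinuousFunction.mkOfCompact ⟨f, hf.continuous⟩).integrable μ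

/-! ### The space of probabilities on the symbolic space, with the Monge–Kantorovich metric -/

/-- Borel probabilities on `Omega m`. This type carries the Monge–Kantorovich metric, its topology
and its Borel σ-algebra. -/
def Prob (m : ℕ) : Type := ProbabilityMeasure (Omega m)

/-- The underlying Borel probability. -/
def Prob.meas {m : ℕ} (μ : Prob m) : ProbabilityMeasure (Omega m) := μ

/-- The Monge–Kantorovich (Hutchinson, 1-Wasserstein) distance. -/
def dMK {m : ℕ} (μ ν : Prob m) : ℝ :=
  ⨆ f : {f : Omega m → ℝ // IsLip1 f},
    (∫ x, f.1 x ∂(μ.meas : Measure (Omega m)) - ∫ x, f.1 x ∂(ν.meas : Measure (Omega m)))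

theorem integral_sub_le_one {m : ℕ} {f : Omega m → ℝ} (hf : IsLip1 f) (μ ν : Prob m) :
    ∫ x, f x ∂(μ.meas : Measure (Omega m)) - ∫ x, f x ∂(ν.meas : Measure (Omega m)) ≤ 1 := by
  have h (x y : Omega m) : f x ≤ f y + 1 := by
    have := (abs_le.1 ((hf x y).trans (dOmega_le_one x y))).2
    linarith
  have h1 (y : Omega m) : ∫ x, f x ∂(μ.meas : Measure (Omega m)) ≤ f y + 1 := by
    have := integral_mono (hf.integrable (μ.meas : Measure (Omega m)))
      (integrable_const (f y + 1)) (fun x => h x y)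
    simpa using this
  have h2 := integral_mono (integrable_const (∫ x, f x ∂(μ.meas : Measure (Omega m))))
      ((hf.integrable (ν.meas : Measure (Omega m))).add (integrable_const (1 : ℝ))) h1
  have h3 : ∫ y, (f y + 1) ∂(ν.meas : Measure (Omega m))
      = ∫ y, f y ∂(ν.meas : Measure (Omega m)) + 1 := by
    rw [integral_add (hf.integrable _) (integrable_const _)]; simp
  have h4 : ∫ x, f x ∂(μ.meas : Measure (Omega m))
      ≤ ∫ y, f y ∂(ν.meas : Measure (Omega m)) + 1 := by
    rw [← h3]; simpa using h2
  linarith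

theorem isLip1_zero {m : ℕ} : IsLip1 (fun _ : Omega m => (0 : ℝ)) := fun x y => by
  simpa using dOmega_nonneg x y

instance {m : ℕ} : Nonempty {f : Omega m → ℝ // IsLip1 f} := ⟨⟨_, isLip1_zero⟩⟩

theorem dMK_bddAbove {m : ℕ} (μ ν : Prob m) :
    BddAbove (Set.range fun f : {f : Omega m → ℝ // IsLip1 f} =>
      (∫ x, f.1 x ∂(μ.meas : Measure (Omega m)) - ∫ x, f.1 x ∂(ν.meas : Measure (Omega m)))) :=
  ⟨1, by rintro _ ⟨f, rfl⟩; exact integral_sub_le_one f.2 μ ν⟩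

theorem le_dMK {m : ℕ} {f : Omega m → ℝ} (hf : IsLip1 f) (μ ν : Prob m) :
    ∫ x, f x ∂(μ.meas : Measure (Omega m)) - ∫ x, f x ∂(ν.meas : Measure (Omega m)) ≤ dMK μ ν :=
  le_ciSup (dMK_bddAbove μ ν) ⟨f, hf⟩

theorem IsLip1.neg {m : ℕ} {f : Omega m → ℝ} (hf : IsLip1 f) : IsLip1 (fun x => -f x) :=
  fun x y => by
    rw [show -f x - -f y = -(f x - f y) by ring, abs_neg]
    exact hf x y

theorem abs_integral_sub_le_dMK {m : ℕ} {f : Omega m → ℝ} (hf : IsLip1 f) (μ ν : Prob m) :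
    |∫ x, f x ∂(μ.meas : Measure (Omega m)) - ∫ x, f x ∂(ν.meas : Measure (Omega m))|
      ≤ dMK μ ν := by
  rw [abs_le]
  have h := le_dMK hf.neg μ ν
  rw [integral_neg, integral_neg] at h
  exact ⟨by linarith, le_dMK hf μ ν⟩

theorem dMK_le_comm {m : ℕ} (μ ν : Prob m) : dMK μ ν ≤ dMK ν μ :=
  ciSup_le fun f => by
    have := le_dMK f.2.neg ν μ
    rw [integral_neg, integral_neg] at this
    linarith

theorem eq_of_dMK_eq_zero {m : ℕ} {μ ν : Prob m} (h : dMK μ ν = 0) : μ = ν := by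
  let _ : MetricSpace (Omega m) := PiNat.metricSpace
  have key : Tendsto (fun _ : ℕ => μ.meas) atTop (𝓝 ν.meas) := by
    rw [tendsto_iff_forall_lipschitz_integral_tendsto]
    rintro f - ⟨L, hL⟩
    have hg : IsLip1 (fun x => f x / (2 * L + 1)) := by
      intro x y
      have hpos : (0 : ℝ) < 2 * L + 1 := by positivity
      rw [← sub_div, abs_div, abs_of_pos hpos, div_le_iff₀ hpos]
      have h1 := hL.dist_le_mul x y
      rw [Real.dist_eq] at h1
      refine h1.trans ?_
      by_cases hxy : x = y
      · simp [hxy, dOmega]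
      · have h2 : dist x y = 2 * dOmega x y := by
          rw [PiNat.dist_eq_of_ne hxy, dOmega, if_neg hxy, pow_succ]; ring
        rw [h2]
        nlinarith [dOmega_nonneg x y]
    have h3 := abs_integral_sub_le_dMK hg μ ν
    rw [h, integral_div, integral_div, ← sub_div] at h3
    have h4 := abs_eq_zero.1 (le_antisymm h3 (abs_nonneg _))
    have hpos : (2 * (L : ℝ) + 1) ≠ 0 := by positivity
    rw [div_eq_zero_iff, or_iff_left hpos, sub_eq_zero] at h4
    rw [h4]
    exact tendsto_const_nhds
  exact tendsto_nhds_unique (X := ProbabilityMeasure (Omega m)) (tendsto_const_nhds (f := atTop)) key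

instance (m : ℕ) : MetricSpace (Prob m) where
  dist := dMK
  dist_self μ := by simp [dMK]
  dist_comm μ ν := le_antisymm (dMK_le_comm μ ν) (dMK_le_comm ν μ)
  dist_triangle μ ν ρ := ciSup_le fun f => by
    have h1 := le_dMK f.2 μ ν
    have h2 := le_dMK f.2 ν ρ
    linarith
  eq_of_dist_eq_zero := eq_of_dMK_eq_zero

instance (m : ℕ) : MeasurableSpace (Prob m) := borel (Prob m)

instance (m : ℕ) : BorelSpace (Prob m) := ⟨rfl⟩

/-- View a Borel probability as a point of the metric space `Prob m`. -/
def Prob.of {m : ℕ} (μ : ProbabilityMeasure (Omega m)) : Prob m := μ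

/-- Indicator of the cylinder of a finite word. -/
def cyl {m k : ℕ} (w : Fin k → Fin m) (x : Omega m) : ℝ :=
  if w = (fun i : Fin k => x i) then 1 else 0

theorem continuous_cyl {m k : ℕ} (w : Fin k → Fin m) : Continuous (cyl w) :=
  (continuous_of_discreteTopology (f := fun v : Fin k → Fin m => if w = v then (1 : ℝ) else 0)).comp
    (by fun_prop : Continuous fun (x : Omega m) (i : Fin k) => x i)

theorem dMK_le_cyl {m : ℕ} (k : ℕ) (μ ν : Prob m) :
    dMK μ ν ≤ 2 * (1 / 2 : ℝ) ^ k + ∑ w : Fin k → Fin m,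
      |∫ x, cyl w x ∂(μ.meas : Measure (Omega m)) - ∫ x, cyl w x ∂(ν.meas : Measure (Omega m))| := by
  obtain ⟨x₀⟩ := μ.meas.nonempty
  refine ciSup_le fun ⟨f, hf⟩ => ?_
  let ext (w : Fin k → Fin m) : Omega m := fun i => if h : i < k then w ⟨i, h⟩ else x₀ i
  let g (x : Omega m) : ℝ := ∑ w : Fin k → Fin m, (f (ext w) - f x₀) * cyl w x
  have hint (w : Fin k → Fin m) (ρ : Prob m) : Integrable (cyl w) (ρ.meas : Measure (Omega m)) :=
    (BoundedContinuousFunction.mkOfCompact ⟨cyl w, continuous_cyl w⟩).integrable _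
  have hgI (ρ : Prob m) : Integrable g (ρ.meas : Measure (Omega m)) :=
    integrable_finsetSum _ fun w _ => (hint w ρ).const_mul _
  have hg (x : Omega m) : g x = f (ext fun i => x i) - f x₀ := by
    simp [g, cyl]
  have hfg (x : Omega m) : |(f x - f x₀) - g x| ≤ (1 / 2 : ℝ) ^ k := by
    rw [hg, show f x - f x₀ - (f (ext fun i => x i) - f x₀) = f x - f (ext fun i => x i) by ring]
    refine (hf _ _).trans (dOmega_le fun i hi => ?_)
    simp [ext, hi]
  have hclose (ρ : Prob m) : |(∫ x, f x ∂(ρ.meas : Measure (Omega m)) - f x₀)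
      - ∫ x, g x ∂(ρ.meas : Measure (Omega m))| ≤ (1 / 2 : ℝ) ^ k := by
    have h1 : (∫ x, f x ∂(ρ.meas : Measure (Omega m)) - f x₀)
        - ∫ x, g x ∂(ρ.meas : Measure (Omega m))
        = ∫ x, ((f x - f x₀) - g x) ∂(ρ.meas : Measure (Omega m)) := by
      have h2 : Integrable (fun x => f x - f x₀) (ρ.meas : Measure (Omega m)) :=
        (hf.integrable _).sub (integrable_const _)
      rw [integral_sub h2 (hgI ρ), integral_sub (hf.integrable _) (integrable_const _)]
      simp
    rw [h1]
    have := norm_integral_le_of_norm_le_const (μ := (ρ.meas : Measure (Omega m)))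
      (f := fun x => (f x - f x₀) - g x) (C := (1 / 2 : ℝ) ^ k) (Eventually.of_forall hfg)
    simpa using this
  have hgi (ρ : Prob m) : ∫ x, g x ∂(ρ.meas : Measure (Omega m))
      = ∑ w : Fin k → Fin m, (f (ext w) - f x₀) * ∫ x, cyl w x ∂(ρ.meas : Measure (Omega m)) := by
    simp only [g]
    rw [integral_finsetSum _ fun w _ => (hint w ρ).const_mul _]
    simp_rw [integral_const_mul]
  have hgd : ∫ x, g x ∂(μ.meas : Measure (Omega m)) - ∫ x, g x ∂(ν.meas : Measure (Omega m))
      ≤ ∑ w : Fin k → Fin m, |∫ x, cyl w x ∂(μ.meas : Measure (Omega m))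
        - ∫ x, cyl w x ∂(ν.meas : Measure (Omega m))| := by
    rw [hgi, hgi, ← Finset.sum_sub_distrib]
    refine Finset.sum_le_sum fun w _ => ?_
    rw [← mul_sub]
    refine (le_abs_self _).trans ?_
    rw [abs_mul]
    exact mul_le_of_le_one_left (abs_nonneg _) ((hf _ _).trans (dOmega_le_one _ _))
  have h1 := abs_le.1 (hclose μ)
  have h2 := abs_le.1 (hclose ν)
  show ∫ x, f x ∂(μ.meas : Measure (Omega m)) - ∫ x, f x ∂(ν.meas : Measure (Omega m)) ≤ _
  linarith [h1.1, h1.2, h2.1, h2.2]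

/-- Weak-* convergence implies Monge–Kantorovich convergence. -/
theorem continuous_of {m : ℕ} : Continuous (Prob.of (m := m)) := by
  rw [continuous_iff_continuousAt]
  intro ν
  rw [ContinuousAt, tendsto_iff_dist_tendsto_zero, Metric.tendsto_nhds]
  intro ε hε
  obtain ⟨k, hk⟩ := exists_pow_lt_of_lt_one (show 0 < ε / 4 by positivity)
    (show (1 / 2 : ℝ) < 1 by norm_num)
  have hc : Continuous fun μ : ProbabilityMeasure (Omega m) => ∑ w : Fin k → Fin m,
      |∫ x, cyl w x ∂(μ : Measure (Omega m)) - ∫ x, cyl w x ∂(ν : Measure (Omega m))| := by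
    refine continuous_finsetSum _ fun w _ => ?_
    have := ProbabilityMeasure.continuous_integral_continuousMap (X := Omega m)
      (⟨cyl w, continuous_cyl w⟩ : C(Omega m, ℝ))
    exact (this.sub continuous_const).abs
  have h0 := hc.tendsto ν
  simp only [sub_self, abs_zero, Finset.sum_const_zero] at h0
  filter_upwards [h0.eventually (gt_mem_nhds (show 0 < ε / 4 by positivity))] with μ hμ
  rw [Real.dist_eq, sub_zero, abs_of_nonneg dist_nonneg]
  have h1 : dist (Prob.of μ) (Prob.of ν) ≤ _ := dMK_le_cyl k (Prob.of μ) (Prob.of ν)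
  refine h1.trans_lt ?_
  have h2 : ∑ w : Fin k → Fin m, |∫ x, cyl w x ∂((Prob.of μ).meas : Measure (Omega m))
      - ∫ x, cyl w x ∂((Prob.of ν).meas : Measure (Omega m))| < ε / 4 := hμ
  linarith

/-- The Monge–Kantorovich topology is the weak-* topology. -/
def homeo (m : ℕ) : ProbabilityMeasure (Omega m) ≃ₜ Prob m :=
  Continuous.homeoOfEquivCompactToT2 (f := Equiv.refl (ProbabilityMeasure (Omega m)))
    (continuous_of (m := m))

theorem continuous_meas {m : ℕ} : Continuous (Prob.meas (m := m)) := (homeo m).symm.continuous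

instance (m : ℕ) : CompactSpace (Prob m) := (homeo m).compactSpace

/-! ### The push-forward map, the convolution and the maps of the IFS -/

theorem continuous_shift {m : ℕ} : Continuous (shift (m := m)) := by
  unfold shift; fun_prop

theorem continuous_concat {m : ℕ} (n : ℕ) :
    Continuous fun p : Omega m × Omega m => concat n p.1 p.2 := by
  refine continuous_pi fun i => ?_
  unfold concat
  split_ifs <;> fun_prop

/-- The push-forward map `μ ↦ μ ∘ σ⁻¹` on the space of probabilities. -/
def pushForward {m : ℕ} (μ : Prob m) : Prob m :=
  Prob.of (μ.meas.map (f := shift) continuous_shift.aemeasurable)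

/-- The convolution `η *_n μ`, the image of the product probability `η × μ` under `R_n`. -/
def convolve {m : ℕ} (n : ℕ) (η μ : Prob m) : Prob m :=
  Prob.of ((η.meas.prod μ.meas).map (f := fun p : Omega m × Omega m => concat n p.1 p.2)
    (continuous_concat n).aemeasurable)

/-- The maps of the IFS, `phi n ν μ = φ_ν(μ) = 𝔗(ν) *_n μ`. -/
def phi {m : ℕ} (n : ℕ) (ν μ : Prob m) : Prob m := convolve n (pushForward ν) μ

theorem continuous_pushForward {m : ℕ} : Continuous (pushForward (m := m)) :=
  continuous_of.comp ((ProbabilityMeasure.continuous_map continuous_shift).comp continuous_meas)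

theorem continuous_phi {m : ℕ} (n : ℕ) : Continuous fun p : Prob m × Prob m => phi n p.1 p.2 := by
  refine continuous_of.comp ((ProbabilityMeasure.continuous_map (continuous_concat n)).comp ?_)
  exact ProbabilityMeasure.continuous_prod.comp
    ((continuous_meas.comp (continuous_pushForward.comp continuous_fst)).prodMk
      (continuous_meas.comp continuous_snd))

/-! ### The Ruelle operator -/

/-- Borel probabilities on the space `Prob m`. -/
abbrev Prob2 (m : ℕ) : Type := ProbabilityMeasure (Prob m)

theorem continuous_integrand {m : ℕ} (n : ℕ) (A F : C(Prob m, ℝ)) :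
    Continuous fun p : Prob m × Prob m =>
      Real.exp (A (phi n p.2 p.1)) * F (phi n p.2 p.1) := by
  have h : Continuous fun p : Prob m × Prob m => phi n p.2 p.1 :=
    (continuous_phi n).comp continuous_swap
  fun_prop

theorem integrable_integrand {m : ℕ} (n : ℕ) (A F : C(Prob m, ℝ)) (P₀ : Prob2 m) (μ : Prob m) :
    Integrable (fun ν => Real.exp (A (phi n ν μ)) * F (phi n ν μ)) (P₀ : Measure (Prob m)) :=
  (BoundedContinuousFunction.mkOfCompact
    ⟨fun ν => Real.exp (A (phi n ν μ)) * F (phi n ν μ),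
      (continuous_integrand n A F).comp (continuous_const.prodMk continuous_id)⟩).integrable _

theorem continuous_ruelle {m : ℕ} (n : ℕ) (A F : C(Prob m, ℝ)) (P₀ : Prob2 m) :
    Continuous fun μ : Prob m => ∫ ν, Real.exp (A (phi n ν μ)) * F (phi n ν μ)
      ∂(P₀ : Measure (Prob m)) := by
  have := continuous_parametric_integral_of_continuous (μ := (P₀ : Measure (Prob m)))
    (f := fun μ ν => Real.exp (A (phi n ν μ)) * F (phi n ν μ)) (continuous_integrand n A F)
    (isCompact_univ (X := Prob m))
  simpa using this

/-- The Level-2 IFS Ruelle operator, as a bounded operator on the Banach space of continuous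
functions on `Prob m`: `(B F)(μ) = ∫ e^{A(φ_ν(μ))} F(φ_ν(μ)) dP₀(ν)`. -/
def ruelle {m : ℕ} (n : ℕ) (A : C(Prob m, ℝ)) (P₀ : Prob2 m) :
    C(Prob m, ℝ) →L[ℝ] C(Prob m, ℝ) :=
  LinearMap.mkContinuous
    { toFun := fun F =>
        ⟨fun μ => ∫ ν, Real.exp (A (phi n ν μ)) * F (phi n ν μ) ∂(P₀ : Measure (Prob m)),
          continuous_ruelle n A F P₀⟩
      map_add' := fun F G => by
        ext μ
        simp only [ContinuousMap.coe_mk, ContinuousMap.add_apply, mul_add]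
        exact integral_add (integrable_integrand n A F P₀ μ) (integrable_integrand n A G P₀ μ)
      map_smul' := fun c F => by
        ext μ
        simp only [ContinuousMap.coe_mk, ContinuousMap.smul_apply, smul_eq_mul, RingHom.id_apply]
        rw [← integral_const_mul]
        exact integral_congr_ae (Eventually.of_forall fun ν => by ring) }
    (Real.exp ‖A‖) fun F => by
      rw [ContinuousMap.norm_le _ (by positivity)]
      intro μ
      have h := norm_integral_le_of_norm_le_const (μ := (P₀ : Measure (Prob m)))
        (f := fun ν => Real.exp (A (phi n ν μ)) * F (phi n ν μ)) (C := Real.exp ‖A‖ * ‖F‖)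
        (Eventually.of_forall fun ν => by
          rw [norm_mul, Real.norm_eq_abs, Real.abs_exp]
          gcongr
          · exact (le_abs_self _).trans (A.norm_coe_le_norm _)
          · exact F.norm_coe_le_norm _)
      simpa using h

theorem ruelle_apply {m : ℕ} (n : ℕ) (A F : C(Prob m, ℝ)) (P₀ : Prob2 m) (μ : Prob m) :
    ruelle n A P₀ F μ
      = ∫ ν, Real.exp (A (phi n ν μ)) * F (phi n ν μ) ∂(P₀ : Measure (Prob m)) := rfl

/-- `eigenProbabilities n A P₀ ρ` is the set of probabilities `Π` with `B* Π = ρ Π`, where the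
dual operator is given by `∫ F d(B* Π) = ∫ (B F) dΠ` for all continuous `F`. -/
def eigenProbabilities {m : ℕ} (n : ℕ) (A : C(Prob m, ℝ)) (P₀ : Prob2 m) (ρ : ℝ) :
    Set (Prob2 m) :=
  {P | ∀ F : C(Prob m, ℝ),
    ∫ μ, ruelle n A P₀ F μ ∂(P : Measure (Prob m)) = ρ * ∫ μ, F μ ∂(P : Measure (Prob m))}

end LevelTwo

end

/-!
The argument works for any positive operator `B` on `C(X, ℝ)`, with `X` compact Hausdorff and
nonempty, such that `B 1` is strictly positive; no fixed point theorem is needed.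

Call `r > 0` *separated* when `r F - B F` is strictly positive for some `F`. Large `r` are separated
by `F = 1`, and small `r` by `F = -1`. A separating `F` either takes a negative value or is strictly
positive, as `F ≥ 0` gives `r F > B F ≥ 0`. A single `r` does not admit both a strictly positive `G`
and an `F` taking a negative value: subtract from `F` the multiple `c G`, with `c < 0` the minimum of
`F / G`, and look at a point where the nonnegative function `F - c G` vanishes
(`nonneg_of_forall_smul_sub_apply_pos`). The two kinds of separated `r` thus form disjoint nonempty
open subsets of `(0, ∞)`, which is connected, so some `ρ > 0` is not separated
(`exists_forall_exists_smul_sub_apply_nonpos`).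

For such a `ρ` the range of `ρ - B` misses the open cone of strictly positive functions. A functional
separating the two (Hahn–Banach) vanishes on the range and, up to sign, is positive; after
normalisation it is a probability by the Riesz–Markov–Kakutani theorem
(`exists_probabilityMeasure_of_disjoint_pos`): this is the eigenprobability. As the range of `ρ - B`
does not contain `1`, `ρ` lies in the spectrum of `B`, and hence `ρ` is at most the spectral radius.
-/

namespace LevelTwo

open scoped CompactlySupported

variable {X : Type*} [TopologicalSpace X]

/-! ### Strictly positive functions and positive operators -/

theorem convex_setOf_forall_pos : Convex ℝ {F : C(X, ℝ) | ∀ x, 0 < F x} := by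
  intro F hF G hG a b ha hb hab x
  have : 0 < a • F x + b • G x :=
    (convex_Ioi (0 : ℝ)) (Set.mem_Ioi.2 (hF x)) (Set.mem_Ioi.2 (hG x)) ha hb hab
  simpa using this

variable [CompactSpace X]

theorem isOpen_setOf_forall_pos : IsOpen {F : C(X, ℝ) | ∀ x, 0 < F x} := by
  simpa [Set.MapsTo] using
    ContinuousMap.isOpen_setOfPred_mapsTo (X := X) (Y := ℝ) isCompact_univ (isOpen_Ioi (a := 0))

theorem isOpen_setOf_smul_sub_apply_pos (B : C(X, ℝ) →L[ℝ] C(X, ℝ)) (F : C(X, ℝ)) :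
    IsOpen {r : ℝ | ∀ x, 0 < (r • F - B F) x} :=
  isOpen_setOf_forall_pos.preimage (f := fun r : ℝ => r • F - B F) (by fun_prop)

/-- A maximum principle: the minimum of `F / G` cannot be negative. -/
theorem nonneg_of_forall_smul_sub_apply_pos {B : C(X, ℝ) →L[ℝ] C(X, ℝ)}
    (hB : ∀ F, (∀ x, 0 ≤ F x) → ∀ x, 0 ≤ B F x) {r : ℝ} {F G : C(X, ℝ)} (hG : ∀ x, 0 < G x)
    (hrG : ∀ x, 0 < (r • G - B G) x) (hrF : ∀ x, 0 < (r • F - B F) x) (x : X) : 0 ≤ F x := by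
  by_contra! hx
  obtain ⟨y, -, hy⟩ := isCompact_univ.exists_isMinOn ⟨x, Set.mem_univ x⟩
    (f := fun z => F z / G z)
    (F.continuous.div G.continuous fun z => (hG z).ne').continuousOn
  have hmin (z : X) : F y / G y ≤ F z / G z := hy (Set.mem_univ z)
  set c := F y / G y with hc
  have hc0 : c < 0 := (hmin x).trans_lt (div_neg_of_neg_of_pos hx (hG x))
  have h1 := hB (F - c • G) (fun z => by
    have := (le_div_iff₀ (hG z)).1 (hmin z)
    simpa using this) y
  have h2 : F y = c * G y := by rw [hc, div_mul_cancel₀ _ (hG y).ne']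
  have h3 := hrG y
  have h4 := hrF y
  simp only [map_sub, map_smul, ContinuousMap.sub_apply, ContinuousMap.smul_apply,
    smul_eq_mul] at h1 h3 h4
  rw [h2] at h4
  nlinarith

/-- A weak form of the Krein–Rutman theorem: for some `ρ > 0`, the range of `ρ - B` contains no
strictly positive function. -/
theorem exists_forall_exists_smul_sub_apply_nonpos [Nonempty X] {B : C(X, ℝ) →L[ℝ] C(X, ℝ)}
    (hB : ∀ F, (∀ x, 0 ≤ F x) → ∀ x, 0 ≤ B F x) (hB1 : ∀ x, 0 < B 1 x) :
    ∃ ρ : ℝ, 0 < ρ ∧ ∀ F, ∃ x, (ρ • F - B F) x ≤ 0 := by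
  let U : Set ℝ := ⋃ F ∈ {F : C(X, ℝ) | ∀ x, 0 < F x}, {r | ∀ x, 0 < (r • F - B F) x}
  let V : Set ℝ := ⋃ F ∈ {F : C(X, ℝ) | ∃ x, F x < 0}, {r | ∀ x, 0 < (r • F - B F) x}
  have hU : IsOpen U := isOpen_biUnion fun F _ => isOpen_setOf_smul_sub_apply_pos B F
  have hV : IsOpen V := isOpen_biUnion fun F _ => isOpen_setOf_smul_sub_apply_pos B F
  have hU0 : (Set.Ioi 0 ∩ U).Nonempty := by
    refine ⟨‖B 1‖ + 1, Set.mem_Ioi.2 (by positivity), Set.mem_biUnion (x := 1) (by simp) ?_⟩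
    intro x
    have := (le_abs_self _).trans ((B 1).norm_coe_le_norm x)
    simp only [ContinuousMap.sub_apply, ContinuousMap.smul_apply, ContinuousMap.one_apply,
      smul_eq_mul]
    linarith
  have hV0 : (Set.Ioi 0 ∩ V).Nonempty := by
    obtain ⟨y, -, hy⟩ := isCompact_univ.exists_isMinOn Set.univ_nonempty
      (B 1).continuous.continuousOn
    refine ⟨B 1 y / 2, Set.mem_Ioi.2 (half_pos (hB1 y)), Set.mem_biUnion (x := -1) (by simp) ?_⟩
    intro x
    have h1 : B 1 y ≤ B 1 x := hy (Set.mem_univ x)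
    have h2 := hB1 y
    simp only [map_neg, ContinuousMap.sub_apply, ContinuousMap.smul_apply, ContinuousMap.neg_apply,
      ContinuousMap.one_apply, smul_eq_mul]
    linarith
  have hUV : ¬ Set.Ioi 0 ⊆ U ∪ V := fun h => by
    obtain ⟨r, -, hrU, hrV⟩ := isPreconnected_Ioi U V hU hV h hU0 hV0
    obtain ⟨G, hG, hrG⟩ := Set.mem_iUnion₂.1 hrU
    obtain ⟨F, ⟨x, hx⟩, hrF⟩ := Set.mem_iUnion₂.1 hrV
    exact hx.not_ge (nonneg_of_forall_smul_sub_apply_pos hB hG hrG hrF x)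
  obtain ⟨ρ, hρ, hρUV⟩ := Set.not_subset.1 hUV
  refine ⟨ρ, hρ, fun F => ?_⟩
  by_contra! hF
  have hF0 (x : X) : 0 ≤ F x := by
    by_contra! hx
    exact hρUV (Or.inr (Set.mem_biUnion (x := F) ⟨x, hx⟩ hF))
  refine hρUV (Or.inl (Set.mem_biUnion (x := F) (fun x => ?_) hF))
  have h1 := hF x
  have h2 := hB F hF0 x
  simp only [ContinuousMap.sub_apply, ContinuousMap.smul_apply, smul_eq_mul] at h1
  exact pos_of_mul_pos_right (by linarith) (le_of_lt hρ)

/-! ### Probabilities from positive functionals -/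

variable [T2Space X] [MeasurableSpace X] [BorelSpace X]

theorem exists_probabilityMeasure_integral_eq {L : C(X, ℝ) →ₗ[ℝ] ℝ}
    (hL : ∀ F, (∀ x, 0 ≤ F x) → 0 ≤ L F) (hL1 : L 1 = 1) :
    ∃ P : ProbabilityMeasure X, ∀ F : C(X, ℝ), ∫ x, F x ∂(P : Measure X) = L F := by
  let Λ : C_c(X, ℝ) →ₚ[ℝ] ℝ := PositiveLinearMap.mk₀
    { toFun := fun F => L F.toContinuousMap
      map_add' := fun F G => map_add L F.toContinuousMap G.toContinuousMap
      map_smul' := fun c F => map_smul L c F.toContinuousMap }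
    fun F hF => hL F.toContinuousMap hF
  have h (F : C(X, ℝ)) : ∫ x, F x ∂(RealRMK.rieszMeasure Λ) = L F :=
    RealRMK.integral_rieszMeasure Λ ⟨F, HasCompactSupport.of_compactSpace F⟩
  have h1 := h 1
  simp only [ContinuousMap.one_apply, integral_const, smul_eq_mul, mul_one, hL1] at h1
  have hP : IsProbabilityMeasure (RealRMK.rieszMeasure Λ) := by
    constructor
    rwa [measureReal_def, ENNReal.toReal_eq_one_iff] at h1
  exact ⟨⟨_, hP⟩, h⟩

/-- A subspace of `C(X, ℝ)` without strictly positive functions is annihilated by a probability. -/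
theorem exists_probabilityMeasure_of_disjoint_pos {S : Submodule ℝ C(X, ℝ)}
    (hS : ∀ F ∈ S, ∃ x, F x ≤ 0) :
    ∃ P : ProbabilityMeasure X, ∀ F ∈ S, ∫ x, F x ∂(P : Measure X) = 0 := by
  have hdisj : Disjoint {F : C(X, ℝ) | ∀ x, 0 < F x} (S : Set C(X, ℝ)) :=
    Set.disjoint_left.2 fun F hF hFS => by
      obtain ⟨x, hx⟩ := hS F hFS
      exact hx.not_gt (hF x)
  obtain ⟨f, u, hfu, huf⟩ := geometric_hahn_banach_open convex_setOf_forall_pos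
    isOpen_setOf_forall_pos S.convex hdisj
  have hu : u ≤ 0 := by simpa using huf 0 S.zero_mem
  have hpos (F : C(X, ℝ)) (hF : ∀ x, 0 < F x) : f F < 0 := (hfu F hF).trans_le hu
  have h1 : f 1 < 0 := hpos 1 (by simp)
  have hzero (F : C(X, ℝ)) (hF : F ∈ S) : f F = 0 := by
    -- A linear functional bounded below on a subspace vanishes there.
    by_contra hne
    have := huf (((u - 1) / f F) • F) (S.smul_mem _ hF)
    rw [map_smul, smul_eq_mul, div_mul_cancel₀ _ hne] at this
    linarith
  have hnonneg (F : C(X, ℝ)) (hF : ∀ x, 0 ≤ F x) : f F ≤ 0 := by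
    -- Let `ε → 0` in `f (F + ε) < 0`.
    refine le_of_forall_pos_le_add fun ε hε => ?_
    have := hpos (F + (ε / -f 1) • 1) fun x => by
      have h2 : 0 < ε / -f 1 := div_pos hε (neg_pos.2 h1)
      simpa using add_pos_of_nonneg_of_pos (hF x) h2
    rw [map_add, map_smul, smul_eq_mul, div_neg, neg_mul, div_mul_cancel₀ _ h1.ne] at this
    linarith
  obtain ⟨P, hP⟩ := exists_probabilityMeasure_integral_eq (L := ((f 1)⁻¹ • f).toLinearMap)
    (fun F hF => by
      simpa using mul_nonneg_of_nonpos_of_nonpos (inv_nonpos.2 h1.le) (hnonneg F hF))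
    (by simp [h1.ne])
  exact ⟨P, fun F hF => by rw [hP]; simp [hzero F hF]⟩

/-! ### Eigenprobabilities and the spectrum -/

/-- A probability vanishing on the range of `ρ - B` prevents `ρ - B` from being invertible, since
it does not vanish at `1`. -/
theorem mem_spectrum_of_integral_smul_sub_apply_eq_zero {Y : Type*} [TopologicalSpace Y]
    [CompactSpace Y] [MeasurableSpace Y] {B : C(Y, ℝ) →L[ℝ] C(Y, ℝ)} {ρ : ℝ}
    {P : ProbabilityMeasure Y}
    (hP : ∀ F : C(Y, ℝ), ∫ x, (ρ • F - B F) x ∂(P : Measure Y) = 0) : ρ ∈ spectrum ℝ B := by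
  rintro ⟨T, hT⟩
  have h1 : ρ • T.inv 1 - B (T.inv 1) = 1 := by
    have := congr($(T.val_inv) 1)
    rw [hT] at this
    simpa [Algebra.algebraMap_eq_smul_one] using this
  have := hP (T.inv 1)
  rw [h1] at this
  simp at this

theorem exists_eigenprobability [Nonempty X] {B : C(X, ℝ) →L[ℝ] C(X, ℝ)}
    (hB : ∀ F, (∀ x, 0 ≤ F x) → ∀ x, 0 ≤ B F x) (hB1 : ∀ x, 0 < B 1 x) :
    ∃ ρ : ℝ, 0 < ρ ∧ ρ ∈ spectrum ℝ B ∧ ∃ P : ProbabilityMeasure X, ∀ F : C(X, ℝ),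
      ∫ x, B F x ∂(P : Measure X) = ρ * ∫ x, F x ∂(P : Measure X) := by
  obtain ⟨ρ, hρ, h⟩ := exists_forall_exists_smul_sub_apply_nonpos hB hB1
  obtain ⟨P, hP⟩ := exists_probabilityMeasure_of_disjoint_pos
    (S := (ρ • ContinuousLinearMap.id ℝ C(X, ℝ) - B).range) (by
      rintro _ ⟨F, rfl⟩
      exact h F)
  have hP' (F : C(X, ℝ)) : ∫ x, (ρ • F - B F) x ∂(P : Measure X) = 0 := hP _ ⟨F, rfl⟩
  have hint (F : C(X, ℝ)) : Integrable F (P : Measure X) :=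
    (BoundedContinuousFunction.mkOfCompact F).integrable _
  refine ⟨ρ, hρ, mem_spectrum_of_integral_smul_sub_apply_eq_zero hP', P, fun F => ?_⟩
  have h0 := hP' F
  simp only [ContinuousMap.sub_apply, ContinuousMap.smul_apply, smul_eq_mul] at h0
  rw [integral_sub ((hint F).const_mul ρ) (hint _), integral_const_mul] at h0
  linarith

end LevelTwo

open LevelTwo in
theorem mainTheorem2 (m n : ℕ) (A : C(LevelTwo.Prob m, ℝ)) (P₀ : LevelTwo.Prob2 m) :
    ∃ ρ : ℝ, 0 < ρ ∧ ENNReal.ofReal ρ ≤ spectralRadius ℝ (LevelTwo.ruelle n A P₀) ∧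
      (LevelTwo.eigenProbabilities n A P₀ ρ).Nonempty := by
  have : Nonempty (Prob m) := P₀.nonempty
  obtain ⟨ρ, hρ, hspec, P, hP⟩ := exists_eigenprobability (B := ruelle n A P₀)
    (fun F hF μ => integral_nonneg fun ν => mul_nonneg (Real.exp_pos _).le (hF _))
    (fun μ => by
      have h := integrable_integrand n A 1 P₀ μ
      rw [ruelle_apply]
      simp only [ContinuousMap.one_apply, mul_one] at h ⊢
      exact integral_exp_pos h)
  refine ⟨ρ, hρ, ?_, P, hP⟩
  have h : ENNReal.ofReal ρ = ‖ρ‖₊ := by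
    rw [← Real.enorm_of_nonneg hρ.le, enorm_eq_nnnorm]
  rw [h, spectralRadius]
  exact le_iSup₂ (f := fun k (_ : k ∈ spectrum ℝ (ruelle n A P₀)) => (‖k‖₊ : ENNReal)) ρ hspec
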